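/- Let $n\ge 2$ and let $SD_{8n}=\langle a,b \mid a^{4n}=b^2=1,\ bab=a^{2n-1}\rangle$ be the semidihedral group of order $8n$. Let $G=SD_{8n}$ be viewed as a subgroup of $S_{4n}$, the group of permutations of the residues modulo $4n$, through the embedding $a\mapsto (t\mapsto t+1)$, $b\mapsto (t\mapsto (2n-1)t)$. Let $h\in C^{\dagger}_{even}=\{2,4,\dots,2n-2\}$, put $\omega=e^{i\pi/(2n)}$, and let $\varsigma=\varsigma_h$ be the character of the degree-$2$ irreducible representation $$\rho^h(a^r)=\begin{pmatrix}\omega^{hr}&0\\0&\omega^{(2n-1)hr}\end{pmatrix},\qquad \rho^h(ba^r)=\begin{pmatrix}0&\omega^{(2n-1)hr}\\ \omega^{hr}&0\end{pmatrix}$$ of $G$, so that $\varsigma_h(a^r)=2\cos\frac{hr\pi}{2n}$ and $\varsigma_h(ba^r)=0$. Let $V$ be a complex inner product space of finite dimension $d\ge 2$ with an orthonormal basis $e_1,\dots,e_d$, and let $\bigotimes_1^{4n}V$ carry the induced inner product, $\langle \otimes_i v_i,\otimes_i u_i\rangle=\prod_i\langle v_i,u_i\rangle$. For $\sigma\in G$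 let $P_\sigma$ be the linear operator on $\bigotimes_1^{4n}V$ with $P_\sigma(\otimes_i v_i)=\otimes_i v_{\sigma^{-1}(i)}$, and let $$T(G,\varsigma)=\frac{\varsigma(1)}{|G|}\sum_{\sigma\in G}\varsigma(\sigma)P_\sigma .$$ The symmetry class of tensors $V_\varsigma(G)$ is the image of $T(G,\varsigma)$, and for $\alpha\in\{1,\dots,d\}^{4n}$ put $e^*_\alpha=T(G,\varsigma)(\otimes_i e_{\alpha_i})$. Then $V_\varsigma(G)$ has an orthogonal basis consisting of tensors of the form $e^*_\alpha$ if and only if $\nu_2\!\left(\frac{h}{2n}\right)<0$, where $\nu_2$ is the $2$-adic valuation on $\mathbb{Q}$. Moreover, $\nu_2\!\left(\frac{h}{2n}\right)<0$ holds if and only if every power of $2$ that divides $h$ also divides $n$. -/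

import Mathlib

open scoped TensorProduct

/-- The semidihedral group `SD_{8n} = ⟨a, b ∣ a^{4n} = b² = 1, b a b = a^{2n-1}⟩`, through its
normal forms: `a r` is `a^r` and `ba r` is `b a^r`, with `r` taken modulo `4n`. -/
inductive SemiDihedral (n : ℕ) : Type
  | a : ZMod (4 * n) → SemiDihedral n
  | ba : ZMod (4 * n) → SemiDihedral n
  deriving DecidableEq

namespace SemiDihedral

variable {n : ℕ}

/-- The exponent `2n - 1` modulo `4n`. -/
def twist (n : ℕ) : ZMod (4 * n) := 2 * (n : ZMod (4 * n)) - 1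

theorem twist_mul_twist (n : ℕ) : twist n * twist n = 1 := by
  have h : (4 : ZMod (4 * n)) * n = 0 := by
    have := ZMod.natCast_self (4 * n)
    push_cast at this
    exact this
  unfold twist
  linear_combination ((n : ZMod (4 * n)) - 1) * h

theorem twist_twist (x : ZMod (4 * n)) : twist n * (twist n * x) = x := by
  rw [← mul_assoc, twist_mul_twist, one_mul]

/-- Multiplication of normal forms, by the rule `a^k b = b a^{(2n-1)k}`. -/
def mul : SemiDihedral n → SemiDihedral n → SemiDihedral n
  | a i, a j => a (i + j)
  | a i, ba j => ba (twist n * i + j)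
  | ba i, a j => ba (i + j)
  | ba i, ba j => a (twist n * i + j)

/-- Inverses of normal forms. -/
def inv : SemiDihedral n → SemiDihedral n
  | a i => a (-i)
  | ba i => ba (-(twist n * i))

instance : Group (SemiDihedral n) where
  mul := mul
  one := a 0
  inv := inv
  mul_assoc := by
    rintro (x | x) (y | y) (z | z)
    · exact congrArg a (by ring)
    · exact congrArg ba (by ring)
    · exact congrArg ba (by ring)
    · exact congrArg a (by rw [mul_add, twist_twist]; ring)
    · exact congrArg ba (by ring)
    · exact congrArg a (by ring)
    · exact congrArg a (by ring)
    · exact congrArg ba (by rw [mul_add, twist_twist]; ring)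
  one_mul := by
    rintro (x | x)
    · exact congrArg a (zero_add x)
    · exact congrArg ba (by ring)
  mul_one := by
    rintro (x | x)
    · exact congrArg a (add_zero x)
    · exact congrArg ba (add_zero x)
  inv_mul_cancel := by
    rintro (x | x)
    · exact congrArg a (neg_add_cancel x)
    · exact congrArg a (by rw [mul_neg, twist_twist, neg_add_cancel])

theorem one_def : (1 : SemiDihedral n) = a 0 := rfl
theorem a_mul_a (i j : ZMod (4 * n)) : a i * a j = a (i + j) := rfl
theorem a_mul_ba (i j : ZMod (4 * n)) : a i * ba j = ba (twist n * i + j) := rfl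
theorem ba_mul_a (i j : ZMod (4 * n)) : ba i * a j = ba (i + j) := rfl
theorem ba_mul_ba (i j : ZMod (4 * n)) : ba i * ba j = a (twist n * i + j) := rfl

/-- The normal forms are two copies of `ℤ/4nℤ`. -/
def equivSum (n : ℕ) : ZMod (4 * n) ⊕ ZMod (4 * n) ≃ SemiDihedral n where
  toFun := Sum.elim a ba
  invFun
    | a i => Sum.inl i
    | ba i => Sum.inr i
  left_inv := by rintro (x | x) <;> rfl
  right_inv := by rintro (x | x) <;> rfl

instance [NeZero n] : Fintype (SemiDihedral n) := Fintype.ofEquiv _ (equivSum n)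

/-- The embedding `T : SD_{8n} ↪ S_{4n}`, where `S_{4n}` permutes the residues modulo `4n`:
`T(a)(t) = t + 1` and `T(b)(t) = (2n - 1) t`. -/
def embed (n : ℕ) : SemiDihedral n →* Equiv.Perm (ZMod (4 * n)) where
  toFun
    | a i => ⟨fun t => t + i, fun t => t - i, fun t => by ring, fun t => by ring⟩
    | ba i => ⟨fun t => twist n * (t + i), fun t => twist n * t - i,
        fun t => by simp [twist_twist], fun t => by simp [twist_twist]⟩
  map_one' := Equiv.ext fun t => add_zero t
  map_mul' := by
    rintro (x | x) (y | y) <;> refine Equiv.ext fun t => ?_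
    · change t + (x + y) = t + y + x
      ring
    · change twist n * (t + (twist n * x + y)) = twist n * (t + y) + x
      linear_combination twist_twist x
    · change twist n * (t + (x + y)) = twist n * (t + y + x)
      ring
    · change t + (twist n * x + y) = twist n * (twist n * (t + y) + x)
      linear_combination -twist_twist (t + y)

/-- For `n ≥ 2` this is an embedding, so that `SD_{8n}` is a subgroup of `S_{4n}`. -/
theorem embed_injective (hn : 2 ≤ n) : Function.Injective (embed n) := by
  rw [injective_iff_map_eq_one]
  rintro (x | x) h
  · have h0 : (0 : ZMod (4 * n)) + x = 0 := Equiv.congr_fun h 0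
    rw [zero_add] at h0
    rw [h0]; rfl
  · exfalso
    have h0 : twist n * (0 + x) = 0 := Equiv.congr_fun h 0
    have h1 : twist n * (1 + x) = 1 := Equiv.congr_fun h 1
    have h2 : ((2 * n - 2 : ℕ) : ZMod (4 * n)) = 0 := by
      rw [Nat.cast_sub (by omega)]
      push_cast
      unfold twist at h0 h1
      linear_combination h1 - h0
    rw [ZMod.natCast_eq_zero_iff] at h2
    exact absurd (Nat.le_of_dvd (by omega) h2) (by omega)

/-- The representation `ρ^h` of degree two: with `ω = exp(iπ/2n)`,
`ρ^h(a^r) = diag(ω^{hr}, ω^{(2n-1)hr})`, and `ρ^h(b a^r)` has the antidiagonal entries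
`ω^{(2n-1)hr}` (above) and `ω^{hr}` (below). Here `ZMod.stdAddChar` is `r ↦ ω^r` on `ℤ/4nℤ`. -/
noncomputable def rho (n : ℕ) [NeZero n] (h : ℕ) : SemiDihedral n →* Matrix (Fin 2) (Fin 2) ℂ where
  toFun
    | a r => !![ZMod.stdAddChar ((h : ZMod (4 * n)) * r), 0;
                0, ZMod.stdAddChar (twist n * (h : ZMod (4 * n)) * r)]
    | ba r => !![0, ZMod.stdAddChar (twist n * (h : ZMod (4 * n)) * r);
                 ZMod.stdAddChar ((h : ZMod (4 * n)) * r), 0]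
  map_one' := by
    change !![_, _; _, _] = _
    simp [Matrix.one_fin_two]
  map_mul' := by
    rintro (x | x) (y | y)
    · change !![_, _; _, _] = !![_, _; _, _] * !![_, _; _, _]
      simp [mul_add, AddChar.map_add_eq_mul]
    · change !![_, _; _, _] = !![_, _; _, _] * !![_, _; _, _]
      have e1 : (h : ZMod (4 * n)) * (twist n * x + y) = twist n * h * x + h * y := by ring
      have e2 : twist n * (h : ZMod (4 * n)) * (twist n * x + y)
          = h * x + twist n * h * y := by
        linear_combination (h : ZMod (4 * n)) * twist_twist x
      simp [e1, e2, AddChar.map_add_eq_mul]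
    · change !![_, _; _, _] = !![_, _; _, _] * !![_, _; _, _]
      simp [mul_add, AddChar.map_add_eq_mul]
    · change !![_, _; _, _] = !![_, _; _, _] * !![_, _; _, _]
      have e1 : (h : ZMod (4 * n)) * (twist n * x + y) = twist n * h * x + h * y := by ring
      have e2 : twist n * (h : ZMod (4 * n)) * (twist n * x + y)
          = h * x + twist n * h * y := by
        linear_combination (h : ZMod (4 * n)) * twist_twist x
      simp [e1, e2, AddChar.map_add_eq_mul]

/-- The character `ς_h` of `ρ^h`. -/
noncomputable def varsigma (n : ℕ) [NeZero n] (h : ℕ) (g : SemiDihedral n) : ℂ :=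
  (rho n h g).trace

/-- `C₁ = {0, 2, 4, …, 2n}`. -/
def C₁ (n : ℕ) : Set ℕ := {h | Even h ∧ h ≤ 2 * n}

/-- `C†_even = C₁ ∖ {0, 2n}`. -/
def CDaggerEven (n : ℕ) : Set ℕ := C₁ n \ {0, 2 * n}

end SemiDihedral

namespace SymmetryClass

section TensorInner

variable {ι : Type*} [Fintype ι] [DecidableEq ι]
  {V : Type*} [NormedAddCommGroup V] [InnerProductSpace ℂ V] [FiniteDimensional ℂ V]

/-- The inner product that `V` induces on `⨂ V`, in coordinates with respect to the tensor
products of the vectors of an orthonormal basis of `V`. By `tensorInner_tprod` it does not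
depend on that basis. -/
noncomputable def tensorInner (x y : ⨂[ℂ] _ : ι, V) : ℂ :=
  ∑ α : ι → Fin (Module.finrank ℂ V),
    starRingEnd ℂ
        ((Basis.piTensorProduct fun _ : ι => (stdOrthonormalBasis ℂ V).toBasis).repr x α) *
      (Basis.piTensorProduct fun _ : ι => (stdOrthonormalBasis ℂ V).toBasis).repr y α

/-- The induced inner product is determined by `⟨⊗ vᵢ, ⊗ uᵢ⟩ = ∏ ⟨vᵢ, uᵢ⟩`. -/
theorem tensorInner_tprod (v u : ι → V) :
    tensorInner (PiTensorProduct.tprod ℂ v) (PiTensorProduct.tprod ℂ u)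
      = ∏ i, inner ℂ (v i) (u i) := by
  unfold tensorInner
  simp only [Basis.piTensorProduct_repr_tprod_apply, OrthonormalBasis.coe_toBasis_repr_apply,
    map_prod, ← Finset.prod_mul_distrib]
  have key : ∀ i, inner ℂ (v i) (u i) = ∑ k,
      starRingEnd ℂ ((stdOrthonormalBasis ℂ V).repr (v i) k)
        * (stdOrthonormalBasis ℂ V).repr (u i) k := by
    intro i
    rw [← (stdOrthonormalBasis ℂ V).repr.inner_map_map, PiLp.inner_apply]
    exact Finset.sum_congr rfl fun k _ => by rw [RCLike.inner_apply, mul_comm]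
  simp only [key]
  rw [Finset.prod_univ_sum, Fintype.piFinset_univ]

end TensorInner

variable {G : Type*} [Group G] [Fintype G] {ι : Type*}
  {V : Type*} [NormedAddCommGroup V] [InnerProductSpace ℂ V]

/-- `P_σ (v₁ ⊗ ⋯ ⊗ v_m) = v_{σ⁻¹(1)} ⊗ ⋯ ⊗ v_{σ⁻¹(m)}`. -/
noncomputable def permOp (V : Type*) [NormedAddCommGroup V] [InnerProductSpace ℂ V]
    (σ : Equiv.Perm ι) : (⨂[ℂ] _ : ι, V) →ₗ[ℂ] (⨂[ℂ] _ : ι, V) :=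
  (PiTensorProduct.reindex ℂ (fun _ : ι => V) σ).toLinearMap

theorem permOp_tprod (σ : Equiv.Perm ι) (v : ι → V) :
    permOp V σ (PiTensorProduct.tprod ℂ v) = PiTensorProduct.tprod ℂ fun i => v (σ⁻¹ i) :=
  PiTensorProduct.reindex_tprod σ v

/-- The symmetry operator `T(G, χ) = (χ(1) / |G|) ∑_{g ∈ G} χ(g) P_g` of the group `G` of
permutations of `ι`, embedded by `T`. -/
noncomputable def symmetryOp (V : Type*) [NormedAddCommGroup V] [InnerProductSpace ℂ V]
    (T : G →* Equiv.Perm ι) (χ : G → ℂ) : (⨂[ℂ] _ : ι, V) →ₗ[ℂ] (⨂[ℂ] _ : ι, V) :=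
  (χ 1 / (Fintype.card G : ℂ)) • ∑ g : G, χ g • permOp V (T g)

/-- The symmetry class of tensors `V_χ(G)`. -/
noncomputable def symmetryClass (V : Type*) [NormedAddCommGroup V] [InnerProductSpace ℂ V]
    (T : G →* Equiv.Perm ι) (χ : G → ℂ) : Submodule ℂ (⨂[ℂ] _ : ι, V) :=
  LinearMap.range (symmetryOp V T χ)

/-- The decomposable symmetrized tensor `e*_α = e_{α₁} * ⋯ * e_{α_m}`. -/
noncomputable def eStar {κ : Type*} (T : G →* Equiv.Perm ι) (χ : G → ℂ) (e : κ → V)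
    (α : ι → κ) : ⨂[ℂ] _ : ι, V :=
  symmetryOp V T χ (PiTensorProduct.tprod ℂ fun i => e (α i))

/-- `V_χ(G)` has an orthogonal `*`-basis with respect to `e`: for some set `S` of multi-indices
the tensors `e*_α`, `α ∈ S`, are pairwise orthogonal and form a basis of `V_χ(G)`. -/
def HasOrthogonalStarBasis [Fintype ι] [DecidableEq ι] [FiniteDimensional ℂ V] {κ : Type*}
    (T : G →* Equiv.Perm ι) (χ : G → ℂ) (e : κ → V) : Prop :=
  ∃ (S : Set (ι → κ)) (B : Module.Basis S ℂ (symmetryClass V T χ)),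
    (∀ α : S, (B α : ⨂[ℂ] _ : ι, V) = eStar T χ e α) ∧
    ∀ α β : S, α ≠ β → tensorInner (B α : ⨂[ℂ] _ : ι, V) (B β : ⨂[ℂ] _ : ι, V) = 0

end SymmetryClass

/-!
On the cyclic subgroup `⟨a⟩` one has `ς = ψ + ψ⁻¹` with `ψ(a^r) = ω^{hr}` and `ψ ≠ ψ⁻¹`, and `ς`
vanishes elsewhere. Hence `e*_α = w + w'` up to a scalar, where `w` and `w'` are the isotypic parts
of `e_α` under the action of `⟨a⟩`. They are orthogonal of equal norm, and `e*_{gα}` is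
`ψ(g)⁻¹ w + ψ(g) w'`, so that `⟨e*_α, e*_{gα}⟩` is proportional to `ς(g) ‖w‖²`. If `ς` has a zero
`g` on `⟨a⟩`, the tensors `e*_α` and `e*_{gα}`, with `α` running through orbit representatives, form
an orthogonal basis once the zero tensors are dropped. If `ς` has no zero on `⟨a⟩`, two distinct
tensors of one orbit with `w ≠ 0` are never orthogonal, whereas the span of such an orbit has
dimension two.

A zero of `ς` on `⟨a⟩` is an `r` with `2hr ≡ 2n` modulo `4n`, and such an `r` exists if and only if
`gcd(h, 2n)` divides `n`; only the prime `2` can obstruct this.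
-/

namespace SymmetryClass

open Submodule
open scoped InnerProductSpace

section OrthogonalSubbasis

variable {X H : Type*} [NormedAddCommGroup H] [InnerProductSpace ℂ H]

/-- Some of the vectors `v x` form an orthogonal basis of the span of all of them. Linear
independence is encoded as the absence of the zero vector. -/
def HasOrthogonalSubbasis (v : X → H) : Prop :=
  ∃ S : Set X, (∀ x ∈ S, v x ≠ 0) ∧ (S.Pairwise fun x y => ⟪v x, v y⟫_ℂ = 0) ∧
    ∀ x, v x ∈ span ℂ (v '' S)

theorem HasOrthogonalSubbasis.const_smul {v : X → H} (hv : HasOrthogonalSubbasis v) {c : ℂ}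
    (hc : c ≠ 0) : HasOrthogonalSubbasis fun x => c • v x := by
  obtain ⟨S, h0, horth, hspan⟩ := hv
  refine ⟨S, fun x hx => smul_ne_zero hc (h0 x hx), fun x hx y hy hxy => ?_, fun x => ?_⟩
  · simp only [inner_smul_left, inner_smul_right, horth hx hy hxy, mul_zero]
  · rw [← Set.image_image (c • ·) v S]
    exact span_image (LinearMap.lsmul ℂ H c) ▸ mem_map_of_mem (hspan x)

theorem hasOrthogonalSubbasis_const_smul_iff {v : X → H} {c : ℂ} (hc : c ≠ 0) :
    (HasOrthogonalSubbasis fun x => c • v x) ↔ HasOrthogonalSubbasis v :=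
  ⟨fun hv => by simpa [smul_smul, hc] using hv.const_smul (inv_ne_zero hc),
    fun hv => hv.const_smul hc⟩

end OrthogonalSubbasis

section Symmetrize

variable {G X H : Type*} [Group G] [NormedAddCommGroup H] [InnerProductSpace ℂ H]
  {ρ : G →* Equiv.Perm X} {b : X → H}

theorem exists_orbit_representatives (ρ : G →* Equiv.Perm X) :
    ∃ rep : X → X, (∀ x, ∃ g, ρ g (rep x) = x) ∧ ∀ g x, rep (ρ g x) = rep x := by
  let orbits := MulAction.orbitRel ρ.range X
  refine ⟨fun x => (Quotient.mk orbits x).out, fun x => ?_, fun g x => ?_⟩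
  · obtain ⟨⟨_, g, rfl⟩, hg⟩ := orbits.symm (Quotient.mk_out (s := orbits) x)
    exact ⟨g, hg⟩
  · exact congrArg Quotient.out
      (Quotient.sound (s := orbits) ⟨⟨ρ g, g, rfl⟩, rfl⟩)

theorem inner_perm_perm (hb : Orthonormal ℂ b) (g : G) (x y : X) :
    ⟪b (ρ g x), b (ρ g y)⟫_ℂ = ⟪b x, b y⟫_ℂ := by
  classical
  simp only [orthonormal_iff_ite.mp hb, EmbeddingLike.apply_eq_iff_eq]

variable {ψ φ : G →* Circle} {χ : G → ℂ}

theorem ne_inv_of_eq_zero (hχ : ∀ g, χ g = ψ g + (ψ g : ℂ)⁻¹) {r : G} (hr : χ r = 0) :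
    ψ ≠ ψ⁻¹ := fun H => by
  have hinv : (ψ r : ℂ)⁻¹ = ψ r := by rw [← Circle.coe_inv, ← MonoidHom.inv_apply, ← H]
  rw [hχ, hinv, add_self_eq_zero] at hr
  exact Circle.coe_ne_zero _ hr

variable [Fintype G]

/-- The vector `∑ χ(g) b_{g x}`: the permutation representation with basis `b`, applied to `b_x`
with the weights `χ`. Up to a scalar, `e*_α` is of this form. -/
noncomputable def symmetrize (ρ : G →* Equiv.Perm X) (χ : G → ℂ) (b : X → H) (x : X) : H :=
  ∑ g, χ g • b (ρ g x)

/-- Up to the factor `|G|`, the component of `b_x` on which `G` acts by the linear character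
`ψ⁻¹`. -/
noncomputable abbrev isotypicPart (ρ : G →* Equiv.Perm X) (ψ : G →* Circle) (b : X → H) (x : X) :
    H :=
  symmetrize ρ (fun g => ψ g) b x

theorem symmetrize_comp_of_support {A : Type*} [Group A] [Fintype A] {f : A →* G}
    (hf : Function.Injective f) (hχ : ∀ g ∉ Set.range f, χ g = 0) :
    symmetrize ρ χ b = symmetrize (ρ.comp f) (χ ∘ f) b := by
  funext x
  exact (Fintype.sum_of_injective f hf _ _ (fun g hg => by rw [hχ g hg, zero_smul])
    fun _ => rfl).symm

theorem symmetrize_eq_isotypicPart_add (hχ : ∀ g, χ g = ψ g + (ψ g : ℂ)⁻¹) (x : X) :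
    symmetrize ρ χ b x = isotypicPart ρ ψ b x + isotypicPart ρ ψ⁻¹ b x := by
  simp only [symmetrize, hχ, add_smul, Finset.sum_add_distrib, MonoidHom.inv_apply,
    Circle.coe_inv]

theorem isotypicPart_apply_perm (g : G) (x : X) :
    isotypicPart ρ ψ b (ρ g x) = (ψ g : ℂ)⁻¹ • isotypicPart ρ ψ b x := by
  simp only [symmetrize, Finset.smul_sum, smul_smul]
  refine Fintype.sum_equiv (Equiv.mulRight g) _ _ fun k => ?_
  rw [Equiv.coe_mulRight, map_mul, map_mul, Equiv.Perm.mul_apply, Circle.coe_mul, mul_comm,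
    mul_inv_cancel_right₀ (Circle.coe_ne_zero _)]

theorem symmetrize_apply_perm (hχ : ∀ g, χ g = ψ g + (ψ g : ℂ)⁻¹) (g : G) (x : X) :
    symmetrize ρ χ b (ρ g x)
      = (ψ g : ℂ)⁻¹ • isotypicPart ρ ψ b x + (ψ g : ℂ) • isotypicPart ρ ψ⁻¹ b x := by
  simp only [symmetrize_eq_isotypicPart_add hχ, isotypicPart_apply_perm, MonoidHom.inv_apply,
    Circle.coe_inv, inv_inv]

theorem isotypicPart_mem_span_range_symmetrize (hψ : ψ ≠ ψ⁻¹)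
    (hχ : ∀ g, χ g = ψ g + (ψ g : ℂ)⁻¹) (x : X) :
    isotypicPart ρ ψ b x ∈ span ℂ (Set.range (symmetrize ρ χ b)) ∧
      isotypicPart ρ ψ⁻¹ b x ∈ span ℂ (Set.range (symmetrize ρ χ b)) := by
  have hmem : ∀ y, symmetrize ρ χ b y ∈ span ℂ (Set.range (symmetrize ρ χ b)) :=
    fun y => subset_span ⟨y, rfl⟩
  obtain ⟨g, hg⟩ := DFunLike.ne_iff.mp hψ
  have hg' : (ψ g : ℂ) - (ψ g : ℂ)⁻¹ ≠ 0 :=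
    sub_ne_zero.mpr fun H => hg (Circle.coe_injective (H.trans (Circle.coe_inv _).symm))
  have hsolve : isotypicPart ρ ψ b x = ((ψ g : ℂ) - (ψ g : ℂ)⁻¹)⁻¹ •
      ((ψ g : ℂ) • symmetrize ρ χ b x - symmetrize ρ χ b (ρ g x)) := by
    rw [eq_inv_smul_iff₀ hg', symmetrize_apply_perm hχ, symmetrize_eq_isotypicPart_add hχ]
    module
  have hleft : isotypicPart ρ ψ b x ∈ span ℂ (Set.range (symmetrize ρ χ b)) :=
    hsolve ▸ smul_mem _ _ (sub_mem (smul_mem _ _ (hmem x)) (hmem _))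
  exact ⟨hleft, (Submodule.add_mem_iff_right _ hleft).mp
    (symmetrize_eq_isotypicPart_add (ρ := ρ) (b := b) hχ x ▸ hmem x)⟩

/-! ### Orthogonality relations -/

theorem inner_symmetrize_eq_zero_of_forall_ne (hb : Orthonormal ℂ b) {χ' : G → ℂ} {x y : X}
    (hxy : ∀ g, ρ g x ≠ y) : ⟪symmetrize ρ χ b x, symmetrize ρ χ' b y⟫_ℂ = 0 := by
  simp only [symmetrize, sum_inner, inner_sum, inner_smul_left, inner_smul_right]
  refine Finset.sum_eq_zero fun k _ => mul_eq_zero_of_right _ (Finset.sum_eq_zero fun g _ => ?_)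
  have hne : ρ g x ≠ ρ k y := fun H => hxy (k⁻¹ * g) (by simp [H])
  rw [hb.inner_eq_zero hne, mul_zero]

theorem inner_isotypicPart_perm (hb : Orthonormal ℂ b) (g : G) (x y : X) :
    ⟪isotypicPart ρ ψ b x, b (ρ g y)⟫_ℂ = (ψ g : ℂ)⁻¹ * ⟪isotypicPart ρ ψ b x, b y⟫_ℂ := by
  simp only [symmetrize, sum_inner, inner_smul_left, Finset.mul_sum, ← mul_assoc]
  refine Fintype.sum_equiv (Equiv.mulLeft g⁻¹) _ _ fun k => ?_
  have hperm : ρ k x = ρ g (ρ (g⁻¹ * k) x) := by simp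
  rw [hperm, inner_perm_perm hb]
  simp [← Circle.coe_inv_eq_conj, mul_comm]

theorem inner_isotypicPart (hb : Orthonormal ℂ b) (x y : X) :
    ⟪isotypicPart ρ ψ b x, isotypicPart ρ φ b y⟫_ℂ
      = (∑ g, ((ψ⁻¹ * φ) g : ℂ)) * ⟪isotypicPart ρ ψ b x, b y⟫_ℂ := by
  conv_lhs => rw [isotypicPart.eq_def ρ φ, symmetrize, inner_sum]
  simp only [inner_smul_right, inner_isotypicPart_perm hb, Finset.sum_mul]
  refine Finset.sum_congr rfl fun g _ => ?_
  rw [MonoidHom.mul_apply, MonoidHom.inv_apply, Circle.coe_mul, Circle.coe_inv]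
  ring

theorem inner_isotypicPart_of_ne (hb : Orthonormal ℂ b) (h : ψ ≠ φ) (x y : X) :
    ⟪isotypicPart ρ ψ b x, isotypicPart ρ φ b y⟫_ℂ = 0 := by
  have hne : Circle.coeHom.comp (ψ⁻¹ * φ) ≠ 1 := fun H => h <| by
    have : ψ⁻¹ * φ = 1 := MonoidHom.ext fun g => Circle.coe_injective (DFunLike.congr_fun H g)
    exact inv_mul_eq_one.mp this
  have hsum : ∑ g, ((ψ⁻¹ * φ) g : ℂ) = 0 := sum_hom_units_eq_zero _ hne
  rw [inner_isotypicPart hb, hsum, zero_mul]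

theorem inner_isotypicPart_inv_self (hb : Orthonormal ℂ b) (x : X) :
    ⟪isotypicPart ρ ψ⁻¹ b x, isotypicPart ρ ψ⁻¹ b x⟫_ℂ
      = ⟪isotypicPart ρ ψ b x, isotypicPart ρ ψ b x⟫_ℂ := by
  classical
  -- The coefficients with respect to `b` of the two sides are complex conjugates.
  rw [← inner_conj_symm (isotypicPart ρ ψ b x), inner_isotypicPart hb, inner_isotypicPart hb]
  simp [symmetrize, orthonormal_iff_ite.mp hb, apply_ite, ← Circle.coe_inv_eq_conj]

theorem inner_symmetrize_perm (hψ : ψ ≠ ψ⁻¹) (hχ : ∀ g, χ g = ψ g + (ψ g : ℂ)⁻¹)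
    (hb : Orthonormal ℂ b) (g : G) (x : X) :
    ⟪symmetrize ρ χ b x, symmetrize ρ χ b (ρ g x)⟫_ℂ
      = χ g * ⟪isotypicPart ρ ψ b x, isotypicPart ρ ψ b x⟫_ℂ := by
  rw [symmetrize_apply_perm hχ, symmetrize_eq_isotypicPart_add hχ, hχ]
  simp only [inner_add_left, inner_add_right, inner_smul_right, inner_isotypicPart_of_ne hb hψ,
    inner_isotypicPart_of_ne hb hψ.symm, inner_isotypicPart_inv_self hb]
  ring

theorem isotypicPart_ne_zero (hb : Orthonormal ℂ b) {x : X}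
    (hx : Function.Injective fun g => ρ g x) : isotypicPart ρ ψ b x ≠ 0 := by
  classical
  have hinner : ⟪b x, isotypicPart ρ ψ b x⟫_ℂ = 1 := by
    have hfix : ∀ g, x = ρ g x ↔ g = 1 := fun g => by
      simpa [eq_comm] using hx.eq_iff (a := g) (b := 1)
    simp [symmetrize, orthonormal_iff_ite.mp hb, hfix]
  exact fun H => by simp [H] at hinner

/-! ### Orthogonal bases and zeros of the character -/

theorem symmetrize_mem_span_pair (hχ : ∀ g, χ g = ψ g + (ψ g : ℂ)⁻¹) {r : G} (hr : χ r = 0)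
    (g : G) (x : X) :
    symmetrize ρ χ b (ρ g x) ∈ span ℂ {symmetrize ρ χ b x, symmetrize ρ χ b (ρ r x)} := by
  have hr' : (ψ r : ℂ)⁻¹ = -ψ r := by rw [hχ] at hr; exact eq_neg_of_add_eq_zero_right hr
  have hr0 := Circle.coe_ne_zero (ψ r)
  refine mem_span_pair.mpr
    ⟨((ψ g : ℂ) + (ψ g : ℂ)⁻¹) / 2, ((ψ g : ℂ) - (ψ g : ℂ)⁻¹) / (2 * ψ r), ?_⟩
  rw [symmetrize_apply_perm hχ, symmetrize_apply_perm hχ, symmetrize_eq_isotypicPart_add hχ, hr']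
  match_scalars <;> field_simp <;> ring

theorem hasOrthogonalSubbasis_symmetrize_of_eq_zero (hχ : ∀ g, χ g = ψ g + (ψ g : ℂ)⁻¹)
    (hb : Orthonormal ℂ b) {r : G} (hr : χ r = 0) :
    HasOrthogonalSubbasis (symmetrize ρ χ b) := by
  have hψ : ψ ≠ ψ⁻¹ := ne_inv_of_eq_zero hχ hr
  obtain ⟨rep, hrep, hrep_perm⟩ := exists_orbit_representatives ρ
  set v := symmetrize ρ χ b
  have hrep_rep : ∀ x, rep (rep x) = rep x := fun x => by
    obtain ⟨g, hg⟩ := hrep x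
    rw [← hrep_perm g, hg]
  have horth : ∀ x, ⟪v x, v (ρ r x)⟫_ℂ = 0 := fun x => by
    rw [inner_symmetrize_perm hψ hχ hb, hr, zero_mul]
  let S : Set X := {y | v y ≠ 0 ∧ (y = rep y ∨ y = ρ r (rep y))}
  have hmem : ∀ y, y = rep y ∨ y = ρ r (rep y) → v y ∈ span ℂ (v '' S) := fun y hy => by
    by_cases h0 : v y = 0
    · rw [h0]; exact zero_mem _
    · exact subset_span ⟨y, ⟨h0, hy⟩, rfl⟩
  refine ⟨S, fun y hy => hy.1, ?_, fun x => ?_⟩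
  · rintro y ⟨-, hy⟩ z ⟨-, hz⟩ hyz
    by_cases horbit : rep z = rep y
    · rw [horbit] at hz
      rcases hy with hy | hy <;> rcases hz with hz | hz
      · exact absurd (hy.trans hz.symm) hyz
      · rw [hz, ← hy]; exact horth y
      · rw [inner_eq_zero_symm, hy, ← hz]; exact horth z
      · exact absurd (hy.trans hz.symm) hyz
    · exact inner_symmetrize_eq_zero_of_forall_ne hb
        fun g hg => horbit (by rw [← hg, hrep_perm])
  · obtain ⟨g, hg⟩ := hrep x
    have hpair : ({v (rep x), v (ρ r (rep x))} : Set H) ⊆ span ℂ (v '' S) :=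
      Set.pair_subset (hmem _ (.inl (hrep_rep x).symm))
        (hmem _ (.inr (by rw [hrep_perm, hrep_rep])))
    rw [← hg]
    exact span_le.mpr hpair (symmetrize_mem_span_pair hχ hr g (rep x))

theorem isotypicPart_eq_zero_of_orbit_inter_subset (hψ : ψ ≠ ψ⁻¹)
    (hχ : ∀ g, χ g = ψ g + (ψ g : ℂ)⁻¹) (hb : Orthonormal ℂ b) {S : Set X}
    (hspan : ∀ x, symmetrize ρ χ b x ∈ span ℂ (symmetrize ρ χ b '' S)) {y : X}
    (hy : ∀ g, ρ g y ∈ S → ρ g y = y) : isotypicPart ρ ψ b y = 0 := by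
  -- The difference `u` of the isotypic parts at `y` lies in the span, but is orthogonal to it.
  let u := isotypicPart ρ ψ b y - isotypicPart ρ ψ⁻¹ b y
  have hu_orth : ∀ z ∈ S, ⟪u, symmetrize ρ χ b z⟫_ℂ = 0 := fun z hz => by
    by_cases horbit : ∃ g, ρ g y = z
    · obtain ⟨g, rfl⟩ := horbit
      rw [hy g hz, symmetrize_eq_isotypicPart_add hχ, inner_add_right, inner_sub_left,
        inner_sub_left, inner_isotypicPart_of_ne hb hψ, inner_isotypicPart_of_ne hb hψ.symm,
        inner_isotypicPart_inv_self hb]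
      ring
    · rw [inner_sub_left, inner_symmetrize_eq_zero_of_forall_ne hb (not_exists.mp horbit),
        inner_symmetrize_eq_zero_of_forall_ne hb (not_exists.mp horbit), sub_zero]
  have hu_mem : u ∈ span ℂ (symmetrize ρ χ b '' S) := by
    obtain ⟨hmem, hmem'⟩ := isotypicPart_mem_span_range_symmetrize (ρ := ρ) (b := b) hψ hχ y
    exact span_le.mpr (Set.range_subset_iff.mpr hspan) (sub_mem hmem hmem')
  have hu : u = 0 := by
    have hortho : span ℂ {u} ⟂ span ℂ (symmetrize ρ χ b '' S) := isOrtho_span.mpr <| by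
      rintro _ rfl _ ⟨z, hz, rfl⟩
      exact hu_orth z hz
    exact inner_self_eq_zero.mp (hortho.inner_eq (mem_span_singleton_self u) hu_mem)
  rw [← inner_self_eq_zero (𝕜 := ℂ)]
  calc ⟪isotypicPart ρ ψ b y, isotypicPart ρ ψ b y⟫_ℂ
      = ⟪isotypicPart ρ ψ b y, u⟫_ℂ := by
        rw [inner_sub_right, inner_isotypicPart_of_ne hb hψ, sub_zero]
    _ = 0 := by rw [hu, inner_zero_right]

theorem exists_eq_zero_of_hasOrthogonalSubbasis_symmetrize (hψ : ψ ≠ ψ⁻¹)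
    (hχ : ∀ g, χ g = ψ g + (ψ g : ℂ)⁻¹) (hb : Orthonormal ℂ b) {x : X}
    (hx : isotypicPart ρ ψ b x ≠ 0) (hv : HasOrthogonalSubbasis (symmetrize ρ χ b)) :
    ∃ g, χ g = 0 := by
  obtain ⟨S, -, horth, hspan⟩ := hv
  by_contra! hχ0
  obtain ⟨k, hk⟩ : ∃ k, ρ k x ∈ S := by
    by_contra! hS
    exact hx (isotypicPart_eq_zero_of_orbit_inter_subset hψ hχ hb hspan
      fun g hg => absurd hg (hS g))
  have hkx : isotypicPart ρ ψ b (ρ k x) ≠ 0 := by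
    rw [isotypicPart_apply_perm]
    exact smul_ne_zero (inv_ne_zero (Circle.coe_ne_zero _)) hx
  refine hkx (isotypicPart_eq_zero_of_orbit_inter_subset hψ hχ hb hspan fun g hg => ?_)
  by_contra hne
  have hinner : ⟪symmetrize ρ χ b (ρ k x), symmetrize ρ χ b (ρ g (ρ k x))⟫_ℂ = 0 :=
    horth hk hg (Ne.symm hne)
  rw [inner_symmetrize_perm hψ hχ hb] at hinner
  exact mul_ne_zero (hχ0 g) (inner_self_ne_zero.mpr hkx) hinner

theorem hasOrthogonalSubbasis_symmetrize_iff (hψ : ψ ≠ ψ⁻¹)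
    (hχ : ∀ g, χ g = ψ g + (ψ g : ℂ)⁻¹) (hb : Orthonormal ℂ b) {x : X}
    (hx : Function.Injective fun g => ρ g x) :
    HasOrthogonalSubbasis (symmetrize ρ χ b) ↔ ∃ g, χ g = 0 :=
  ⟨exists_eq_zero_of_hasOrthogonalSubbasis_symmetrize hψ hχ hb (isotypicPart_ne_zero hb hx),
    fun ⟨_, hr⟩ => hasOrthogonalSubbasis_symmetrize_of_eq_zero hχ hb hr⟩

end Symmetrize

end SymmetryClass

/-! ### Symmetry classes of tensors -/

namespace SymmetryClass

open Module PiTensorProduct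
open scoped InnerProductSpace

section TensorCoord

variable {ι κ V : Type*} [Fintype ι] [NormedAddCommGroup V] [InnerProductSpace ℂ V]
  [FiniteDimensional ℂ V]

/-- The coordinates of a tensor that define `tensorInner`, as a vector of a Euclidean space. They
make the inner product space library available for tensors. -/
noncomputable def tensorCoord [DecidableEq ι] :
    (⨂[ℂ] _ : ι, V) ≃ₗ[ℂ] EuclideanSpace ℂ (ι → Fin (finrank ℂ V)) :=
  (Basis.piTensorProduct fun _ : ι => (stdOrthonormalBasis ℂ V).toBasis).equivFun ≪≫ₗ
    (WithLp.linearEquiv 2 ℂ _).symm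

variable [DecidableEq ι]

theorem inner_tensorCoord (x y : ⨂[ℂ] _ : ι, V) :
    ⟪tensorCoord x, tensorCoord y⟫_ℂ = tensorInner x y := by
  rw [PiLp.inner_apply, tensorInner]
  exact Finset.sum_congr rfl fun α _ => by rw [RCLike.inner_apply, mul_comm]; rfl

theorem orthonormal_tensorCoord_tprod {e : κ → V} (he : Orthonormal ℂ e) :
    Orthonormal ℂ fun α : ι → κ => tensorCoord (tprod ℂ fun i => e (α i)) := by
  classical
  rw [orthonormal_iff_ite]
  intro α β
  simp only [inner_tensorCoord, tensorInner_tprod, orthonormal_iff_ite.mp he, Finset.prod_ite_zero,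
    Finset.prod_const_one, Finset.mem_univ, true_imp_iff, funext_iff]

end TensorCoord

section StarBasis

variable {G ι κ V : Type*} [Group G] {T : G →* Equiv.Perm ι} {χ : G → ℂ}

/-- The action of `G` on multi-indices for which `P_g` permutes the tensors `⊗ e_{αᵢ}`:
`g` sends `α` to `α ∘ g⁻¹`. -/
def permIndex (T : G →* Equiv.Perm ι) (κ : Type*) : G →* Equiv.Perm (ι → κ) where
  toFun g := (T g).arrowCongr (Equiv.refl κ)
  map_one' := by rw [map_one]; rfl
  map_mul' g k := by rw [map_mul]; rfl

theorem exists_injective_permIndex [Nontrivial κ] {i : ι}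
    (hi : Function.Injective fun g => T g i) :
    ∃ α : ι → κ, Function.Injective fun g => permIndex T κ g α := by
  classical
  obtain ⟨p, q, hpq⟩ := exists_pair_ne κ
  refine ⟨Function.update (fun _ => q) i p, fun g k hgk => hi ?_⟩
  have hp : Function.update (fun _ => q) i p ((T k).symm (T g i)) = p := by
    refine (congrFun hgk (T g i)).symm.trans ?_
    simp [permIndex, Equiv.arrowCongr]
  by_contra hne
  rw [Function.update_of_ne fun H => hne ((Equiv.symm_apply_eq _).mp H)] at hp
  exact hpq hp.symm

variable [NormedAddCommGroup V] [InnerProductSpace ℂ V] [Fintype G]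

theorem eStar_mem_symmetryClass (e : κ → V) (α : ι → κ) :
    eStar T χ e α ∈ symmetryClass V T χ :=
  ⟨_, rfl⟩

theorem span_range_eStar [Finite ι] (e : Basis κ ℂ V) :
    Submodule.span ℂ (Set.range (eStar T χ e)) = symmetryClass V T χ := by
  classical
  have := Fintype.ofFinite ι
  have hrange : Set.range (eStar T χ e)
      = symmetryOp V T χ '' Set.range (Basis.piTensorProduct fun _ : ι => e) := by
    rw [← Set.range_comp]
    exact congrArg Set.range (funext fun α => by simp [eStar, Basis.piTensorProduct_apply])
  rw [hrange, Submodule.span_image, Basis.span_eq, symmetryClass, LinearMap.range_eq_map]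

variable [Fintype ι] [DecidableEq ι] [FiniteDimensional ℂ V]

theorem tensorCoord_eStar (e : κ → V) (α : ι → κ) :
    tensorCoord (eStar T χ e α) = (χ 1 / (Fintype.card G : ℂ)) •
      symmetrize (permIndex T κ) χ (fun α => tensorCoord (tprod ℂ fun i => e (α i))) α := by
  simp only [eStar, symmetryOp, symmetrize, LinearMap.smul_apply, LinearMap.sum_apply,
    permOp_tprod, map_smul, map_sum]
  rfl

theorem HasOrthogonalStarBasis.hasOrthogonalSubbasis {e : κ → V}
    (hT : HasOrthogonalStarBasis T χ e) :
    HasOrthogonalSubbasis fun α => tensorCoord (eStar T χ e α) := by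
  obtain ⟨S, B, hB, horth⟩ := hT
  have hspan : Submodule.span ℂ (eStar T χ e '' S) = symmetryClass V T χ := by
    have hrange : eStar T χ e '' S = (symmetryClass V T χ).subtype '' Set.range B := by
      rw [← Set.range_comp, Set.image_eq_range]
      exact congrArg Set.range (funext fun α => (hB α).symm)
    rw [hrange, Submodule.span_image, B.span_eq, Submodule.map_subtype_top]
  refine ⟨S, fun α hα => ?_, fun α hα β hβ hne => ?_, fun α => ?_⟩
  · beta_reduce
    rw [← hB ⟨α, hα⟩]
    simpa using B.ne_zero ⟨α, hα⟩
  · beta_reduce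
    rw [inner_tensorCoord, ← hB ⟨α, hα⟩, ← hB ⟨β, hβ⟩]
    exact horth _ _ (by simpa using hne)
  · rw [← Set.image_image]
    exact Submodule.apply_mem_span_image_of_mem_span tensorCoord.toLinearMap
      (hspan ▸ eStar_mem_symmetryClass e α)

theorem hasOrthogonalStarBasis_of_hasOrthogonalSubbasis (e : Basis κ ℂ V)
    (hT : HasOrthogonalSubbasis fun α => tensorCoord (eStar T χ e α)) :
    HasOrthogonalStarBasis T χ e := by
  obtain ⟨S, hne, horth, hmem⟩ := hT
  have hli : LinearIndependent ℂ fun α : S => eStar T χ e α :=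
    .of_comp tensorCoord.toLinearMap <| linearIndependent_of_ne_zero_of_inner_eq_zero
      (fun α : S => hne α α.2) fun α β h => horth α.2 β.2 (Subtype.coe_injective.ne h)
  have hspan : Submodule.span ℂ (Set.range fun α : S => eStar T χ e α) = symmetryClass V T χ := by
    refine (Submodule.span_mono ?_).trans_eq (span_range_eStar e) |>.antisymm ?_
    · rintro _ ⟨α, rfl⟩
      exact ⟨α, rfl⟩
    · rw [← span_range_eStar e, Submodule.span_le]
      rintro _ ⟨α, rfl⟩
      have h := hmem α
      rw [← Set.image_image, Set.image_eq_range (eStar T χ e) S] at h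
      simpa using Submodule.apply_mem_span_image_of_mem_span tensorCoord.symm.toLinearMap h
  refine ⟨S, (Basis.span hli).map (LinearEquiv.ofEq _ _ hspan), fun α => ?_, fun α β h => ?_⟩
  · simp [Basis.span_apply]
  · rw [← inner_tensorCoord]
    simpa [Basis.span_apply] using horth α.2 β.2 (Subtype.coe_injective.ne h)

theorem hasOrthogonalStarBasis_iff_exists_eq_zero {A : Type*} [Group A] [Finite A] {f : A →* G}
    {ψ : A →* Circle} (hψ : ψ ≠ ψ⁻¹) (hχ : ∀ a, χ (f a) = ψ a + (ψ a : ℂ)⁻¹)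
    (hχ0 : ∀ g ∉ Set.range f, χ g = 0) {i : ι} (hi : Function.Injective fun a => T (f a) i)
    [Fintype κ] [Nontrivial κ] (e : OrthonormalBasis κ ℂ V) :
    HasOrthogonalStarBasis T χ e ↔ ∃ a, χ (f a) = 0 := by
  have := Fintype.ofFinite A
  have hf : Function.Injective f := fun a b hab => hi (by simp only [hab])
  have hχ1 : χ 1 / (Fintype.card G : ℂ) ≠ 0 := by
    have h2 : χ 1 = 2 := by rw [← map_one f, hχ]; norm_num
    simp [h2]
  obtain ⟨α, hα⟩ := exists_injective_permIndex (T := T.comp f) (κ := κ) hi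
  calc HasOrthogonalStarBasis T χ e
    _ ↔ HasOrthogonalSubbasis fun α => tensorCoord (eStar T χ e α) :=
      ⟨HasOrthogonalStarBasis.hasOrthogonalSubbasis, fun H =>
        e.coe_toBasis ▸ hasOrthogonalStarBasis_of_hasOrthogonalSubbasis e.toBasis
          (e.coe_toBasis ▸ H)⟩
    _ ↔ HasOrthogonalSubbasis (symmetrize (permIndex T κ) χ _) := by
      simp only [tensorCoord_eStar]
      exact hasOrthogonalSubbasis_const_smul_iff hχ1
    _ ↔ HasOrthogonalSubbasis (symmetrize (permIndex (T.comp f) κ) (χ ∘ f) _) := by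
      rw [symmetrize_comp_of_support hf hχ0]; rfl
    _ ↔ ∃ a, χ (f a) = 0 :=
      hasOrthogonalSubbasis_symmetrize_iff hψ hχ (orthonormal_tensorCoord_tprod e.orthonormal) hα

end StarBasis

end SymmetryClass

section PadicValuation

variable {p m n : ℕ} [hp : Fact p.Prime]

theorem gcd_mul_dvd_iff_padicValNat_le (hm : m ≠ 0) (hn : n ≠ 0) :
    m.gcd (p * n) ∣ n ↔ padicValNat p m ≤ padicValNat p n := by
  have hp0 := hp.out.ne_zero
  rw [← Nat.factorization_le_iff_dvd (Nat.gcd_ne_zero_left hm) hn,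
    Nat.factorization_gcd hm (mul_ne_zero hp0 hn), Nat.factorization_mul hp0 hn,
    hp.out.factorization, ← Nat.factorization_def m hp.out, ← Nat.factorization_def n hp.out]
  refine ⟨fun H => ?_, fun H q => ?_⟩
  · have hmin : min (m.factorization p) (1 + n.factorization p) ≤ n.factorization p := by
      simpa using H p
    omega
  · obtain rfl | hq := eq_or_ne q p
    · exact inf_le_of_left_le H
    · exact inf_le_of_right_le (by simp [hq.symm])

theorem padicValRat_div_mul_neg_iff (hm : m ≠ 0) (hn : n ≠ 0) :
    padicValRat p ((m : ℚ) / (p * n)) < 0 ↔ padicValNat p m ≤ padicValNat p n := by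
  have hpq : (p : ℚ) ≠ 0 := Nat.cast_ne_zero.mpr hp.out.ne_zero
  have hmq : (m : ℚ) ≠ 0 := Nat.cast_ne_zero.mpr hm
  have hnq : (n : ℚ) ≠ 0 := Nat.cast_ne_zero.mpr hn
  rw [padicValRat.div hmq (mul_ne_zero hpq hnq), padicValRat.mul hpq hnq,
    padicValRat.self hp.out.one_lt, padicValRat.of_nat, padicValRat.of_nat]
  omega

theorem padicValNat_le_iff_forall_pow_dvd (hm : m ≠ 0) (hn : n ≠ 0) :
    padicValNat p m ≤ padicValNat p n ↔ ∀ k : ℕ, p ^ k ∣ m → p ^ k ∣ n := by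
  simp only [padicValNat_dvd_iff_le hm, padicValNat_dvd_iff_le hn]
  exact ⟨fun H k hk => hk.trans H, fun H => H _ le_rfl⟩

end PadicValuation

/-! ### The character of the semidihedral group -/

namespace SemiDihedral

variable {n h : ℕ}

theorem twist_mul_of_even (hh : Even h) : twist n * (h : ZMod (4 * n)) = -h := by
  obtain ⟨k, rfl⟩ := hh
  have h4 : (4 * n : ZMod (4 * n)) = 0 := by exact_mod_cast ZMod.natCast_self (4 * n)
  push_cast [twist]
  linear_combination (k : ZMod (4 * n)) * h4

theorem not_two_mul_dvd_of_mem_CDaggerEven (hh : h ∈ CDaggerEven n) : ¬ 2 * n ∣ h := fun H =>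
  hh.2 <| (Nat.eq_zero_or_pos h).imp_right fun h0 => hh.1.2.antisymm (Nat.le_of_dvd h0 H)

/-- The inclusion of the cyclic subgroup `⟨a⟩`, on which `ς_h` is supported. -/
def rotation (n : ℕ) : Multiplicative (ZMod (4 * n)) →* SemiDihedral n where
  toFun r := a r.toAdd
  map_one' := rfl
  map_mul' _ _ := rfl

variable [NeZero n]

/-- The linear character `a^r ↦ ω^{hr}` of `⟨a⟩`. -/
noncomputable def rotationChar (n : ℕ) [NeZero n] (h : ℕ) :
    Multiplicative (ZMod (4 * n)) →* Circle :=
  (AddChar.mulShift ZMod.toCircle (h : ZMod (4 * n))).toMonoidHom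

theorem rotationChar_apply (r : Multiplicative (ZMod (4 * n))) :
    rotationChar n h r = ZMod.toCircle ((h : ZMod (4 * n)) * r.toAdd) :=
  rfl

theorem varsigma_rotation (hh : Even h) (r : Multiplicative (ZMod (4 * n))) :
    varsigma n h (rotation n r) = rotationChar n h r + (rotationChar n h r : ℂ)⁻¹ := by
  have htrace : varsigma n h (rotation n r) = ZMod.stdAddChar ((h : ZMod (4 * n)) * r.toAdd)
      + ZMod.stdAddChar (twist n * (h : ZMod (4 * n)) * r.toAdd) := Matrix.trace_fin_two_of _ _ _ _
  rw [htrace, twist_mul_of_even hh, neg_mul, AddChar.map_neg_eq_inv, ZMod.stdAddChar_apply,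
    rotationChar_apply]

theorem varsigma_eq_zero_of_notMem_range {g : SemiDihedral n} (hg : g ∉ Set.range (rotation n)) :
    varsigma n h g = 0 := by
  rcases g with r | r
  · exact absurd ⟨.ofAdd r, rfl⟩ hg
  · exact (Matrix.trace_fin_two_of _ _ _ _).trans (add_zero 0)

theorem rotationChar_ne_inv (hnh : ¬ 2 * n ∣ h) : rotationChar n h ≠ (rotationChar n h)⁻¹ := by
  intro H
  have h1 := DFunLike.congr_fun H (.ofAdd 1)
  rw [MonoidHom.inv_apply, rotationChar_apply, ← AddChar.map_neg_eq_inv,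
    ZMod.injective_toCircle.eq_iff, toAdd_ofAdd, mul_one, eq_neg_iff_add_eq_zero] at h1
  have h2 : 2 * (2 * n) ∣ 2 * h := by
    rw [← mul_assoc, ← ZMod.natCast_eq_zero_iff (2 * h) (2 * 2 * n)]
    push_cast
    rw [two_mul]
    exact h1
  exact hnh (Nat.dvd_of_mul_dvd_mul_left two_pos h2)

theorem toCircle_two_mul_self : (ZMod.toCircle (2 * n : ZMod (4 * n)) : ℂ) = -1 := by
  have hn : (n : ℂ) ≠ 0 := Nat.cast_ne_zero.mpr (NeZero.ne n)
  have hexp := ZMod.toCircle_intCast (N := 4 * n) (2 * n)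
  push_cast at hexp
  rw [hexp, ← Complex.exp_pi_mul_I]
  congr 1
  field_simp
  ring

theorem varsigma_rotation_eq_zero_iff (hh : Even h) (r : Multiplicative (ZMod (4 * n))) :
    varsigma n h (rotation n r) = 0 ↔
      2 * ((h : ZMod (4 * n)) * r.toAdd) = (2 * n : ZMod (4 * n)) := by
  set ω := ZMod.toCircle ((h : ZMod (4 * n)) * r.toAdd)
  have hω : (ω : ℂ) ≠ 0 := Circle.coe_ne_zero _
  calc varsigma n h (rotation n r) = 0
    _ ↔ (ω : ℂ) + (ω : ℂ)⁻¹ = 0 := by rw [varsigma_rotation hh, rotationChar_apply]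
    _ ↔ (ω : ℂ) * ω = -1 := by
      rw [← mul_left_inj' hω, add_mul, inv_mul_cancel₀ hω, zero_mul, add_eq_zero_iff_eq_neg]
    _ ↔ ω * ω = ZMod.toCircle (2 * n : ZMod (4 * n)) := by
      rw [← toCircle_two_mul_self (n := n), ← Circle.coe_mul, Circle.coe_inj]
    _ ↔ 2 * ((h : ZMod (4 * n)) * r.toAdd) = (2 * n : ZMod (4 * n)) := by
      rw [← AddChar.map_add_eq_mul, ZMod.injective_toCircle.eq_iff, ← two_mul]

theorem exists_varsigma_rotation_eq_zero_iff (hh : Even h) :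
    (∃ r, varsigma n h (rotation n r) = 0) ↔ h.gcd (2 * n) ∣ n := by
  have hlift : ∀ x : ℤ, 2 * ((h : ZMod (4 * n)) * x) = (2 * n : ZMod (4 * n)) ↔
      (2 * n : ℤ) ∣ n - h * x := fun x => by
    have h4 := ZMod.intCast_eq_intCast_iff_dvd_sub (2 * (h * x)) (2 * n) (4 * n)
    push_cast at h4
    rw [h4, ← mul_sub, show (4 * n : ℤ) = 2 * (2 * n) by ring,
      mul_dvd_mul_iff_left (two_ne_zero' ℤ)]
  calc (∃ r, varsigma n h (rotation n r) = 0)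
    _ ↔ ∃ x : ℤ, (2 * n : ℤ) ∣ n - h * x := by
      simp only [varsigma_rotation_eq_zero_iff hh, Multiplicative.toAdd.exists_congr_left,
        ZMod.intCast_surjective.exists, ← hlift]
      rfl
    _ ↔ h.gcd (2 * n) ∣ n := by
      rw [← Int.gcd_natCast_natCast, Int.gcd_dvd_iff]
      simp only [dvd_def, sub_eq_iff_eq_add']
      push_cast
      rfl

end SemiDihedral

theorem theorem3p4_general (n : ℕ) [NeZero n] {h : ℕ} (hh : Even h) (hnh : ¬ 2 * n ∣ h)
    {V κ : Type*} [NormedAddCommGroup V] [InnerProductSpace ℂ V] [FiniteDimensional ℂ V]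
    [Fintype κ] [Nontrivial κ] (e : OrthonormalBasis κ ℂ V) :
    (SymmetryClass.HasOrthogonalStarBasis (SemiDihedral.embed n) (SemiDihedral.varsigma n h) e ↔
      padicValRat 2 ((h : ℚ) / (2 * n)) < 0) ∧
    (padicValRat 2 ((h : ℚ) / (2 * n)) < 0 ↔ ∀ k : ℕ, 2 ^ k ∣ h → 2 ^ k ∣ n) := by
  have h0 : h ≠ 0 := fun h0 => hnh (h0 ▸ dvd_zero _)
  have hn0 := NeZero.ne n
  have hpadic : padicValRat 2 ((h : ℚ) / (2 * n)) < 0 ↔ padicValNat 2 h ≤ padicValNat 2 n := by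
    exact_mod_cast padicValRat_div_mul_neg_iff (p := 2) h0 hn0
  have hfree : Function.Injective fun r => SemiDihedral.embed n (SemiDihedral.rotation n r) 0 :=
    fun r s hrs => add_left_cancel (a := (0 : ZMod (4 * n))) hrs
  refine ⟨?_, hpadic.trans (padicValNat_le_iff_forall_pow_dvd h0 hn0)⟩
  rw [hpadic, ← gcd_mul_dvd_iff_padicValNat_le h0 hn0,
    ← SemiDihedral.exists_varsigma_rotation_eq_zero_iff hh]
  exact SymmetryClass.hasOrthogonalStarBasis_iff_exists_eq_zero
    (SemiDihedral.rotationChar_ne_inv hnh) (SemiDihedral.varsigma_rotation hh)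
    (fun _ => SemiDihedral.varsigma_eq_zero_of_notMem_range) hfree e

theorem theorem3p4 (n : ℕ) [NeZero n] (hn : 2 ≤ n) (h : ℕ) (hh : h ∈ SemiDihedral.CDaggerEven n)
    {V : Type*} [NormedAddCommGroup V] [InnerProductSpace ℂ V] [FiniteDimensional ℂ V]
    (hV : 2 ≤ Module.finrank ℂ V) (e : OrthonormalBasis (Fin (Module.finrank ℂ V)) ℂ V) :
    (SymmetryClass.HasOrthogonalStarBasis (SemiDihedral.embed n) (SemiDihedral.varsigma n h) e ↔
      padicValRat 2 ((h : ℚ) / (2 * n)) < 0) ∧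
    (padicValRat 2 ((h : ℚ) / (2 * n)) < 0 ↔ ∀ k : ℕ, 2 ^ k ∣ h → 2 ^ k ∣ n) := by
  have := Fin.nontrivial_iff_two_le.mpr hV
  exact theorem3p4_general n hh.1.1 (SemiDihedral.not_two_mul_dvd_of_mem_CDaggerEven hh) e
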